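/- Let $n,k$ be integers with $0\le k\le n$, let $\mathfrak{sl}(n+1)=\mathfrak{sl}(n+1,\mathbb C)$ be the Lie algebra of traceless complex $(n+1)\times(n+1)$ matrices, and let $\mathfrak b$ be a Borel (that is, maximal solvable) subalgebra of it. Call an ideal $\mathfrak i$ of $\mathfrak b$ ad-nilpotent if $\operatorname{ad}x$ is a nilpotent endomorphism of $\mathfrak{sl}(n+1)$ for every $x\in\mathfrak i$. The class of nilpotence of $\mathfrak i$ is the smallest $m\ge 0$ with $\mathfrak i^{(m)}=0$, where $\mathfrak i^{(0)}=\mathfrak i$ and $\mathfrak i^{(m+1)}=[\mathfrak i,\mathfrak i^{(m)}]$ (so the zero ideal has class $0$ and nonzero abelian ideals have class $1$). If $k\ge 1$, then ad-nilpotent ideals of $\mathfrak b$ with class of nilpotence $k$ exist, and the minimal dimension of such an ideal is $$\binom{k+1}{2}+(k-1)(n-k).$$ For every $0\le k\le n$, ad-nilpotent ideals of $\mathfrak b$ with class of nilpotence $k$ exist, and the maximal dimension of such an ideal is $$\binom{n+1}{2}-(n+1)\left\lfloor\frac{n+1}{k+1}\right\rfloor+(k+1)\binom{\left\lfloor\frac{n+1}{k+1}\right\rfloor+1}{2}.$$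 -/

import Mathlib

attribute [local instance 100] LieRing.ofAssociativeRing

/-- The Lie algebra `sl(n+1, ℂ)` of traceless `(n+1) × (n+1)` complex matrices (type `A_n`). -/
abbrev SL (n : ℕ) : LieSubalgebra ℂ (Matrix (Fin (n + 1)) (Fin (n + 1)) ℂ) :=
  LieAlgebra.SpecialLinear.sl (Fin (n + 1)) ℂ

/-- A Borel subalgebra: a maximal solvable subalgebra. -/
def IsBorel {L : Type*} [LieRing L] [LieAlgebra ℂ L] (b : LieSubalgebra ℂ L) : Prop :=
  Maximal (fun c : LieSubalgebra ℂ L => LieAlgebra.IsSolvable c) b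

/-- An ideal of a subalgebra `b` of `L` is ad-nilpotent if each of its elements
acts nilpotently on `L` in the adjoint representation. -/
def IsAdNilpotentIdeal {L : Type*} [LieRing L] [LieAlgebra ℂ L] {b : LieSubalgebra ℂ L}
    (I : LieIdeal ℂ b) : Prop :=
  ∀ x ∈ I, IsNilpotent (LieAlgebra.ad ℂ L (x : L))

/-- The `m`-fold bracketing `[I, [I, …, [I, I]…]]` of an ideal with itself (with `m` brackets);
for `m = 0` it is `I`. -/
def iterBracket {L : Type*} [LieRing L] [LieAlgebra ℂ L] (I : LieIdeal ℂ L) : ℕ → LieIdeal ℂ L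
  | 0 => I
  | m + 1 => ⁅I, iterBracket I m⁆

/-- `k` is the class of nilpotence of the ideal `I`: the smallest `m` such that `m`-fold bracketing
of `I` with itself gives the zero ideal. So only the zero ideal has class `0`, and the abelian
ideals are those of class at most `1`. -/
def HasNilpotenceClass {L : Type*} [LieRing L] [LieAlgebra ℂ L]
    (I : LieIdeal ℂ L) (k : ℕ) : Prop :=
  IsLeast {m : ℕ | iterBracket I m = ⊥} k

/-- The set of dimensions (as integers) of the ad-nilpotent ideals of `b` with class of
nilpotence `k`. -/
def adNilpotentDims {L : Type*} [LieRing L] [LieAlgebra ℂ L] (b : LieSubalgebra ℂ L)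
    (k : ℕ) : Set ℤ :=
  {d : ℤ | ∃ I : LieIdeal ℂ b, IsAdNilpotentIdeal I ∧ HasNilpotenceClass I k ∧
    (Module.finrank ℂ I : ℤ) = d}

/-! By Lie's theorem and maximality, every Borel subalgebra is conjugate to the upper triangular one
(`IsBorel.exists_map_eq_upperBorel`). There the diagonal matrices isolate matrix units, so an
ad-nilpotent ideal is spanned by the units at the positions of an up-closed relation `S` inside `i <
j` (`exists_eq_relIdeal`). Its dimension is the number of pairs of `S`. An `m`-fold bracket is
nonzero exactly when `S` has a chain of `m + 1` pairs, so the class is the length of a longest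
chain. The theorem becomes a count of pairs in `S`.

Minimum: the `k + 1` vertices of a chain are pairwise related, and each of the other `n - k`
vertices is related to all of them but at most two (`card_ge_of_hasChain`).

Maximum: the length of the longest chain ending at a vertex sorts the vertices into `k + 1` levels
with no related pairs inside a level, and the fewest pairs are lost when the levels are balanced
(`card_le_of_not_hasChain`). `smallRel` and `blockRel` attain the two bounds. -/

/-! ### Chains in relations closed upwards, and the sizes of such relations -/

/-- `S` contains, with each pair `(i, j)`, all pairs obtained by decreasing `i` and increasing `j`. -/
def UpClosed {N : ℕ} (S : Fin N → Fin N → Prop) : Prop :=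
  ∀ ⦃a i j b⦄, a ≤ i → j ≤ b → S i j → S a b

/-- `S` contains a chain of `m` consecutive pairs. -/
def HasChain {N : ℕ} (S : Fin N → Fin N → Prop) (m : ℕ) : Prop :=
  ∃ c : ℕ → Fin N, ∀ t < m, S (c t) (c (t + 1))

lemma HasChain.mono {N : ℕ} {S : Fin N → Fin N → Prop} {m l : ℕ} (h : HasChain S m)
    (hl : l ≤ m) : HasChain S l :=
  h.imp fun _ hc t ht => hc t (ht.trans_le hl)

lemma hasChain_zero {n : ℕ} (S : Fin (n + 1) → Fin (n + 1) → Prop) : HasChain S 0 :=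
  ⟨fun _ => 0, by simp⟩

lemma strictMonoOn_of_chain {N m : ℕ} {S : Fin N → Fin N → Prop} (hS : ∀ i j, S i j → i < j)
    {c : ℕ → Fin N} (hc : ∀ t < m, S (c t) (c (t + 1))) {s t : ℕ} (hst : s < t) (ht : t ≤ m) :
    c s < c t := by
  induction t, hst using Nat.le_induction with
  | base => exact hS _ _ (hc s (by omega))
  | succ t hst ih => exact (ih (by omega)).trans (hS _ _ (hc t (by omega)))

lemma card_filter_lt_range (m : ℕ) :
    ((Finset.range m ×ˢ Finset.range m).filter fun p => p.1 < p.2).card = m.choose 2 := by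
  have : ((Finset.range m ×ˢ Finset.range m).filter fun p => p.1 < p.2).card
      = ∑ t ∈ Finset.range m, t := by
    rw [Finset.card_eq_sum_card_fiberwise (f := Prod.snd) (t := Finset.range m)]
    · refine Finset.sum_congr rfl fun t ht => ?_
      conv_rhs => rw [← Finset.card_range t]
      refine Finset.card_bij (fun p _ => p.1) ?_ ?_ ?_
      · rintro ⟨a, b⟩ h
        simp only [Finset.mem_filter, Finset.mem_product, Finset.mem_range] at h ⊢
        omega
      · simp +contextual [Prod.ext_iff]
      · intro s hs
        simp only [Finset.mem_range] at ht hs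
        exact ⟨(s, t), by simp; omega, rfl⟩
    · intro p hp
      simp only [Finset.coe_filter, Finset.mem_product, Finset.mem_range, Set.mem_ofPred_eq] at hp
      simpa using hp.1.2
  rw [this, Finset.sum_range_id, Nat.choose_two_right]

open Classical in
/-- The elements at distance at least two from the gap of the chain in which `v` lies are
related to `v`. -/
lemma sub_two_le_card_related {N k : ℕ} {S : Fin N → Fin N → Prop} (hup : UpClosed S)
    (hS : ∀ i j, S i j → i < j) {c : ℕ → Fin N} (hc : ∀ t < k, S (c t) (c (t + 1))) (v : Fin N) :
    k - 1 ≤ ((Finset.range (k + 1)).filter fun s => S (c s) v ∨ S v (c s)).card := by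
  -- The gap of `v`: `t` is the first index with `v ≤ c t`, or `k + 1` if there is none.
  obtain ⟨t, htk, ht⟩ : ∃ t ≤ k + 1, ∀ s ≤ k, (s < t → c s ≤ v) ∧ (t ≤ s → v ≤ c s) := by
    by_cases h : ∃ t ≤ k, v ≤ c t
    · refine ⟨Nat.find h, by have := (Nat.find_spec h).1; omega, fun s hs => ⟨fun hst => ?_, fun hst => ?_⟩⟩
      · have := Nat.find_min h hst
        push Not at this
        exact (this hs).le
      · refine (Nat.find_spec h).2.trans ?_
        rcases hst.eq_or_lt with h' | h'
        · rw [h']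
        · exact (strictMonoOn_of_chain hS hc h' hs).le
    · push Not at h
      exact ⟨k + 1, le_rfl, fun s hs => ⟨fun _ => (h s hs).le, by omega⟩⟩
  -- For `s + 1 < t` the pair `(c s, c (s + 1))` widens to `(c s, v)`; for `s > t` the pair `(c (s -
  -- 1), c s)` widens to `(v, c s)`. Only the two neighbours of the gap may be unrelated to `v`.
  have hsub : Finset.range (k + 1) \ {t - 1, t} ⊆
      (Finset.range (k + 1)).filter fun s => S (c s) v ∨ S v (c s) := by
    intro s hs
    simp only [Finset.mem_sdiff, Finset.mem_range, Finset.mem_insert, Finset.mem_singleton,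
      not_or] at hs
    simp only [Finset.mem_filter, Finset.mem_range]
    refine ⟨hs.1, ?_⟩
    rcases lt_or_ge s t with h | h
    · exact Or.inl (hup le_rfl ((ht (s + 1) (by omega)).1 (by omega)) (hc s (by omega)))
    · obtain ⟨r, rfl⟩ : ∃ r, s = r + 1 := ⟨s - 1, by omega⟩
      exact Or.inr (hup ((ht r (by omega)).2 (by omega)) le_rfl (hc r (by omega)))
  refine le_trans ?_ (Finset.card_le_card hsub)
  have h1 := Finset.le_card_sdiff ({t - 1, t} : Finset ℕ) (Finset.range (k + 1))
  have h2 := Finset.card_le_two (a := t - 1) (b := t)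
  rw [Finset.card_range] at h1
  omega

-- Pairs inside the chain give the binomial coefficient; pairs joining the chain to an outside
-- vertex give the product, by `sub_two_le_card_related`.
open Classical in
lemma card_ge_of_hasChain {n k : ℕ} {S : Fin (n + 1) → Fin (n + 1) → Prop} (hup : UpClosed S)
    (hS : ∀ i j, S i j → i < j) (hk : HasChain S k) :
    (k + 1).choose 2 + (k - 1) * (n - k) ≤
      (Finset.univ.filter fun p : Fin (n + 1) × Fin (n + 1) => S p.1 p.2).card := by
  obtain ⟨c, hc⟩ := hk
  have hmono := fun {s t : ℕ} => strictMonoOn_of_chain (s := s) (t := t) hS hc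
  have hinj : Set.InjOn c (Finset.range (k + 1)) := by
    intro s hs t ht hst
    simp only [Finset.coe_range, Set.mem_Iio] at hs ht
    rcases lt_trichotomy s t with h | h | h
    · exact absurd hst (hmono h (by omega)).ne
    · exact h
    · exact absurd hst (hmono h (by omega)).ne'
  set C : Finset (Fin (n + 1)) := (Finset.range (k + 1)).image c with hC
  have hCcard : C.card = k + 1 := by rw [hC, Finset.card_image_of_injOn hinj, Finset.card_range]
  have hCc : Cᶜ.card = n - k := by rw [Finset.card_compl, hCcard, Fintype.card_fin]; omega
  set T := Finset.univ.filter fun p : Fin (n + 1) × Fin (n + 1) => S p.1 p.2 with hT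
  have h1 : (k + 1).choose 2 ≤ (T.filter fun p => p.1 ∈ C ∧ p.2 ∈ C).card := by
    rw [← card_filter_lt_range]
    refine Finset.card_le_card_of_injOn (fun p => (c p.1, c p.2)) ?_ ?_
    · rintro ⟨s, t⟩ hp
      simp only [Finset.coe_filter, Finset.mem_product, Finset.mem_range, Set.mem_ofPred_eq] at hp
      obtain ⟨⟨hs, ht⟩, hst⟩ := hp
      simp only [hT, hC, Finset.coe_filter, Finset.mem_filter, Finset.mem_univ, true_and,
        Finset.mem_image, Finset.mem_range, Set.mem_ofPred_eq]
      refine ⟨?_, ⟨s, hs, rfl⟩, ⟨t, ht, rfl⟩⟩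
      refine hup le_rfl ?_ (hc s (by omega))
      rcases (show s + 1 ≤ t from hst).eq_or_lt with h | h
      · rw [h]
      · exact (hmono h (by omega)).le
    · rintro ⟨s, t⟩ hp ⟨s', t'⟩ hp' h
      simp only [Finset.coe_filter, Finset.mem_product, Finset.mem_range, Set.mem_ofPred_eq] at hp hp'
      simp only [Prod.mk.injEq] at h ⊢
      exact ⟨hinj (by simp; omega) (by simp; omega) h.1, hinj (by simp; omega) (by simp; omega) h.2⟩
  have h2 : (k - 1) * (n - k) ≤ (T.filter fun p => ¬ (p.1 ∈ C ∧ p.2 ∈ C)).card := by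
    -- A related pair with exactly one end in `C` determines the outside vertex `v` and the chain
    -- index `s`, so no pair is counted twice.
    have hsum : (Cᶜ.sigma fun v => (Finset.range (k + 1)).filter
        fun s => S (c s) v ∨ S v (c s)).card ≤ (T.filter fun p => ¬ (p.1 ∈ C ∧ p.2 ∈ C)).card := by
      refine Finset.card_le_card_of_injOn
        (fun q => if S (c q.2) q.1 then (c q.2, q.1) else (q.1, c q.2)) ?_ ?_
      · rintro ⟨v, s⟩ hq
        simp only [Finset.coe_sigma, Set.mem_sigma_iff, Finset.mem_coe, Finset.mem_compl,
          Finset.mem_filter] at hq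
        obtain ⟨hv, hs, h⟩ := hq
        simp only [hT, Finset.coe_filter, Finset.mem_filter, Finset.mem_univ, true_and,
          Set.mem_ofPred_eq]
        split_ifs with h'
        · exact ⟨h', fun h => hv h.2⟩
        · exact ⟨h.resolve_left h', fun h => hv h.1⟩
      · rintro ⟨v, s⟩ hq ⟨v', s'⟩ hq' h
        simp only [Finset.coe_sigma, Set.mem_sigma_iff, Finset.mem_coe, Finset.mem_compl,
          Finset.mem_filter] at hq hq'
        have hsC : c s ∈ C := Finset.mem_image_of_mem _ hq.2.1
        have hsC' : c s' ∈ C := Finset.mem_image_of_mem _ hq'.2.1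
        have key : v = v' ∧ c s = c s' := by
          dsimp only at h
          split_ifs at h <;> rw [Prod.mk.injEq] at h
          · exact ⟨h.2, h.1⟩
          · exact absurd (h.2 ▸ hsC') hq.1
          · exact absurd (h.1 ▸ hsC') hq.1
          · exact h
        obtain ⟨rfl, hcs⟩ := key
        rw [hinj (Finset.mem_coe.2 hq.2.1) (Finset.mem_coe.2 hq'.2.1) hcs]
    refine le_trans ?_ hsum
    rw [Finset.card_sigma, mul_comm, ← hCc, ← smul_eq_mul]
    exact Finset.card_nsmul_le_sum _ _ _ fun v _ => sub_two_le_card_related hup hS hc v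
  rw [← Finset.card_filter_add_card_filter_not (s := T) fun p => p.1 ∈ C ∧ p.2 ∈ C]
  exact add_le_add h1 h2

/-! ### Levels and the upper bound -/

open Classical in
lemma card_filter_lt_fin (N : ℕ) : ((Finset.univ : Finset (Fin N × Fin N)).filter
    fun p => p.1 < p.2).card = N.choose 2 := by
  rw [← card_filter_lt_range]
  refine Finset.card_bij (fun p _ => ((p.1 : ℕ), (p.2 : ℕ))) ?_ ?_ ?_
  · rintro ⟨a, b⟩ h
    simpa using h
  · rintro ⟨a, b⟩ _ ⟨a', b'⟩ _ h
    simpa [Fin.ext_iff] using h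
  · rintro ⟨a, b⟩ h
    simp only [Finset.mem_filter, Finset.mem_product, Finset.mem_range] at h
    exact ⟨(⟨a, h.1.1⟩, ⟨b, h.1.2⟩), by simpa using h.2, rfl⟩

open Classical in
/-- Increasing pairs separated by a function are counted by the sizes of its fibres. -/
lemma card_pairs_of_levels {N K : ℕ} (f : Fin N → Fin K) :
    (Finset.univ.filter fun p : Fin N × Fin N => p.1 < p.2 ∧ f p.1 ≠ f p.2).card
      + ∑ j, (Finset.univ.filter fun v => f v = j).card.choose 2 = N.choose 2 := by
  -- The increasing enumeration of `A` reduces the count to `Fin A.card`.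
  have hfib : ∀ A : Finset (Fin N), ((A ×ˢ A).filter fun p => p.1 < p.2).card = A.card.choose 2 := by
    intro A
    rw [← card_filter_lt_fin]
    symm
    refine Finset.card_bij (fun p _ => (A.orderEmbOfFin rfl p.1, A.orderEmbOfFin rfl p.2)) ?_ ?_ ?_
    · rintro ⟨a, b⟩ h
      simpa using h
    · rintro ⟨a, b⟩ _ ⟨a', b'⟩ _ h
      simpa using h
    · rintro ⟨a, b⟩ h
      simp only [Finset.mem_filter, Finset.mem_product] at h
      have hr := Finset.range_orderEmbOfFin A rfl
      obtain ⟨x, hx⟩ : a ∈ Set.range (A.orderEmbOfFin rfl) := by rw [hr]; exact h.1.1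
      obtain ⟨y, hy⟩ : b ∈ Set.range (A.orderEmbOfFin rfl) := by rw [hr]; exact h.1.2
      refine ⟨(x, y), ?_, by simp [hx, hy]⟩
      have := h.2
      rw [← hx, ← hy] at this
      simpa using this
  rw [← card_filter_lt_fin N, ← Finset.card_filter_add_card_filter_not
    (s := Finset.univ.filter fun p : Fin N × Fin N => p.1 < p.2) fun p => f p.1 ≠ f p.2,
    Finset.filter_filter, Finset.filter_filter]
  congr 1
  rw [Finset.card_eq_sum_card_fiberwise (f := fun p => f p.1) (t := Finset.univ) (by simp)]
  refine Finset.sum_congr rfl fun j _ => ?_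
  rw [← hfib]
  congr 1
  ext ⟨a, b⟩
  simp only [Finset.mem_filter, Finset.mem_product, Finset.mem_univ, true_and, not_not]
  constructor
  · rintro ⟨⟨rfl, h⟩, h'⟩
    exact ⟨⟨h', h.symm⟩, rfl⟩
  · rintro ⟨⟨h, h'⟩, rfl⟩
    exact ⟨⟨rfl, h'.symm⟩, h⟩

lemma two_mul_choose_two (m : ℕ) : 2 * (m.choose 2 : ℤ) = m * (m - 1) := by
  induction m with
  | zero => simp
  | succ m ih =>
    rw [Nat.choose_succ_succ' m 1, Nat.choose_one_right]
    push_cast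
    linarith [ih]

/-- A family of `K` sets with sizes summing to `N` has at least as many internal pairs as a
balanced one. -/
lemma sum_choose_two_ge {K : ℕ} (m : Fin K → ℕ) (q : ℕ) :
    (q : ℤ) * ∑ j, (m j : ℤ) - K * ((q + 1).choose 2 : ℤ) ≤ ∑ j, ((m j).choose 2 : ℤ) := by
  -- Twice the difference of the two sides is `(m j - q) * (m j - q - 1)`, which is nonnegative at
  -- integers and vanishes exactly for `m j = q` and `m j = q + 1`.
  have h : ∀ j, (q : ℤ) * m j - ((q + 1).choose 2 : ℤ) ≤ ((m j).choose 2 : ℤ) := by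
    intro j
    have h1 := two_mul_choose_two (m j)
    have h2 := two_mul_choose_two (q + 1)
    push_cast at h2
    have h3 : 0 ≤ ((m j : ℤ) - q) * ((m j : ℤ) - q - 1) := by
      rcases le_or_gt (m j : ℤ) q with h | h
      · nlinarith
      · exact mul_nonneg (by omega) (by omega)
    nlinarith
  calc _ = ∑ j : Fin K, ((q : ℤ) * m j - ((q + 1).choose 2 : ℤ)) := by
        simp [Finset.sum_sub_distrib, Finset.mul_sum]
    _ ≤ _ := Finset.sum_le_sum fun j _ => h j

lemma sum_choose_two_eq {K : ℕ} (m : Fin K → ℕ) (q : ℕ) (hm : ∀ j, m j = q ∨ m j = q + 1) :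
    ∑ j, ((m j).choose 2 : ℤ) = (q : ℤ) * ∑ j, (m j : ℤ) - K * ((q + 1).choose 2 : ℤ) := by
  have h : ∀ j, ((m j).choose 2 : ℤ) = (q : ℤ) * m j - ((q + 1).choose 2 : ℤ) := by
    intro j
    have h1 := two_mul_choose_two (m j)
    have h2 := two_mul_choose_two (q + 1)
    push_cast at h2
    rcases hm j with h | h <;> rw [h] at h1 ⊢ <;> push_cast at h1 ⊢ <;> linarith
  simp [h, Finset.sum_sub_distrib, Finset.mul_sum]

lemma sum_card_fibres {N K : ℕ} (f : Fin N → Fin K) :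
    ∑ j, ((Finset.univ.filter fun v => f v = j).card : ℤ) = N := by
  have h := Finset.card_eq_sum_card_fiberwise (f := f) (s := Finset.univ) (t := Finset.univ)
    (by simp)
  rw [Finset.card_univ, Fintype.card_fin] at h
  exact_mod_cast h.symm

-- Mirsky's argument: a related pair strictly raises the length of the longest chain ending at a
-- vertex, so it joins different levels. Convexity then bounds the pairs lost inside the `k + 1`
-- levels.
open Classical in
lemma card_le_of_not_hasChain {n k : ℕ} {S : Fin (n + 1) → Fin (n + 1) → Prop}
    (hS : ∀ i j, S i j → i < j) (hk : ¬ HasChain S (k + 1)) :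
    ((Finset.univ.filter fun p : Fin (n + 1) × Fin (n + 1) => S p.1 p.2).card : ℤ) ≤
      ((n + 1).choose 2 : ℤ) - ((n : ℤ) + 1) * (((n + 1) / (k + 1) : ℕ) : ℤ)
        + ((k : ℤ) + 1) * ((((n + 1) / (k + 1) + 1).choose 2 : ℕ) : ℤ) := by
  let E : Fin (n + 1) → ℕ → Prop := fun v m =>
    ∃ c : ℕ → Fin (n + 1), c m = v ∧ ∀ t < m, S (c t) (c (t + 1))
  have hE : ∀ v m, E v m → m ≤ k := by
    rintro v m ⟨c, -, hc⟩
    by_contra! h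
    exact hk (HasChain.mono ⟨c, hc⟩ h)
  have hE0 : ∀ v, E v 0 := fun v => ⟨fun _ => v, rfl, by simp⟩
  let f : Fin (n + 1) → Fin (k + 1) := fun v =>
    ⟨Nat.findGreatest (E v) k, Nat.lt_succ_of_le (Nat.findGreatest_le k)⟩
  have hf : ∀ u v, S u v → f u ≠ f v := by
    intro u v huv hfuv
    obtain ⟨c, hcm, hc⟩ := Nat.findGreatest_spec (Nat.zero_le k) (hE0 u)
    set m := Nat.findGreatest (E u) k with hm
    -- A longest chain ending at `u` is prolonged by the pair `(u, v)`.
    have hv : E v (m + 1) := by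
      refine ⟨fun t => if t ≤ m then c t else v, by simp, fun t ht => ?_⟩
      rcases (show t ≤ m by omega).eq_or_lt with h | h
      · simp [h, hcm, huv]
      · have h1 : t + 1 ≤ m := h
        simp [h.le, h1, hc t h]
    have h1 : m + 1 ≤ Nat.findGreatest (E v) k := Nat.le_findGreatest (hE v _ hv) hv
    have h2 : m = Nat.findGreatest (E v) k := congrArg Fin.val hfuv
    omega
  have h1 := card_pairs_of_levels f
  have h2 : (Finset.univ.filter fun p : Fin (n + 1) × Fin (n + 1) => S p.1 p.2).card ≤
      (Finset.univ.filter fun p : Fin (n + 1) × Fin (n + 1) => p.1 < p.2 ∧ f p.1 ≠ f p.2).card :=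
    Finset.card_le_card fun p hp => by
      simp only [Finset.mem_filter, Finset.mem_univ, true_and] at hp ⊢
      exact ⟨hS _ _ hp, hf _ _ hp⟩
  have h3 := sum_choose_two_ge (fun j => (Finset.univ.filter fun v => f v = j).card)
    ((n + 1) / (k + 1))
  rw [sum_card_fibres] at h3
  zify at h1 h2
  push_cast at h1 h2 h3 ⊢
  linarith

/-! ### The relation attaining the minimum -/

/-- A relation with few pairs having longest chain of length `k`. -/
def smallRel (n k : ℕ) (i j : Fin (n + 1)) : Prop :=
  i < j ∧ ((i : ℕ) + 1 < k ∨ (i : ℕ) + 1 = k ∧ (j : ℕ) = n)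

lemma smallRel_upClosed (n k : ℕ) : UpClosed (smallRel n k) := by
  rintro a i j b hai hjb ⟨hij, h⟩
  have := b.2
  simp only [Fin.le_def, Fin.lt_def, smallRel] at *
  omega

lemma hasChain_smallRel {n k : ℕ} (hkn : k ≤ n) : HasChain (smallRel n k) k := by
  -- The chain is `0, 1, …, k - 1, n`.
  refine ⟨fun t => if h : t < k then ⟨t, by omega⟩ else Fin.last n, fun t ht => ?_⟩
  by_cases h : t + 1 < k
  · simp [smallRel, ht, h]
  · simp [smallRel, ht, h, Fin.lt_def]
    omega

/-- The entry of index `k` in a chain is at least `k`, whereas every pair starts at most at `k - 1`.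
-/
lemma not_hasChain_smallRel (n k : ℕ) : ¬ HasChain (smallRel n k) (k + 1) := by
  rintro ⟨c, hc⟩
  have h : ∀ t ≤ k, t ≤ (c t : ℕ) := by
    intro t
    induction t with
    | zero => simp
    | succ t ih =>
      intro ht
      have h1 := (hc t (by omega)).1
      have h2 := ih (by omega)
      rw [Fin.lt_def] at h1
      omega
  have h1 := (hc k (by omega)).2
  have h2 := h k le_rfl
  omega

open Classical in
lemma card_smallRel {n k : ℕ} (hk : 1 ≤ k) (hkn : k ≤ n) :
    ((Finset.univ.filter fun p : Fin (n + 1) × Fin (n + 1) => smallRel n k p.1 p.2).card : ℤ) =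
      ((k + 1).choose 2 : ℤ) + ((k : ℤ) - 1) * ((n : ℤ) - k) := by
  obtain ⟨r, rfl⟩ : ∃ r, k = r + 1 := ⟨k - 1, by omega⟩
  -- The first `r = k - 1` rows are full, and the next one contributes only its last position.
  have hrow : ∀ i : Fin (n + 1), (Finset.univ.filter fun j => smallRel n (r + 1) i j).card =
      if (i : ℕ) < r then n - i else if (i : ℕ) = r then 1 else 0 := by
    intro i
    split_ifs with h1 h2
    · have : (Finset.univ.filter fun j => smallRel n (r + 1) i j) = Finset.Ioi i := by
        ext j
        simp [smallRel, h1]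
      rw [this, Fin.card_Ioi]
      omega
    · rw [Finset.card_eq_one]
      refine ⟨Fin.last n, ?_⟩
      ext j
      simp only [smallRel, Finset.mem_filter, Finset.mem_univ, true_and, Finset.mem_singleton,
        Fin.ext_iff, Fin.lt_def, Fin.val_last]
      omega
    · rw [Finset.card_eq_zero, Finset.filter_eq_empty_iff]
      intro j _ hj
      have := hj.2
      omega
  have hsum : ∀ s ≤ n, 2 * ∑ i ∈ Finset.range s, ((n : ℤ) - i) = 2 * s * n - s * (s - 1) := by
    intro s _
    induction s with
    | zero => simp
    | succ s ih =>
      rw [Finset.sum_range_succ, mul_add, ih (by omega)]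
      push_cast
      ring
  have hcard : ((Finset.univ.filter fun p : Fin (n + 1) × Fin (n + 1) =>
      smallRel n (r + 1) p.1 p.2).card : ℤ) = ∑ i ∈ Finset.range r, ((n : ℤ) - i) + 1 := by
    rw [← Finset.univ_product_univ, Finset.card_filter, Finset.sum_product]
    simp_rw [← Finset.card_filter, hrow]
    rw [Fin.sum_univ_eq_sum_range (fun i => if i < r then n - i else if i = r then 1 else 0) (n + 1),
      ← Finset.sum_subset (Finset.range_subset_range.2 (show r + 1 ≤ n + 1 by omega)),
      Finset.sum_range_succ]
    · push_cast
      simp only [lt_irrefl, if_true, if_false]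
      congr 1
      · refine Finset.sum_congr rfl fun i hi => ?_
        rw [Finset.mem_range] at hi
        rw [if_pos hi]
        omega
    · intro i _ hi
      rw [Finset.mem_range] at hi
      rw [if_neg (by omega), if_neg (by omega)]
  have h1 := hsum r (by omega)
  have h2 := two_mul_choose_two (r + 1 + 1)
  rw [hcard]
  push_cast at h2 ⊢
  linarith

/-! ### The relation attaining the maximum -/

/-- The relation `i < j` between elements in different blocks, for a partition of the `n + 1`
elements into `k + 1` intervals of almost equal length. -/
def blockRel (n k : ℕ) (i j : Fin (n + 1)) : Prop :=
  (i : ℕ) * (k + 1) / (n + 1) < (j : ℕ) * (k + 1) / (n + 1)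

lemma blockRel_upClosed (n k : ℕ) : UpClosed (blockRel n k) := by
  intro a i j b hai hjb h
  have h1 : (a : ℕ) * (k + 1) / (n + 1) ≤ (i : ℕ) * (k + 1) / (n + 1) := by gcongr; exact hai
  have h2 : (j : ℕ) * (k + 1) / (n + 1) ≤ (b : ℕ) * (k + 1) / (n + 1) := by gcongr; exact hjb
  exact h1.trans_lt (lt_of_lt_of_le h h2)

lemma blockRel_lt {n k : ℕ} {i j : Fin (n + 1)} (h : blockRel n k i j) : i < j := by
  by_contra! h'
  refine absurd h (not_lt.2 ?_)
  gcongr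
  exact h'

/-- The index of the block of an element. -/
def blockIndex (n k : ℕ) (i : Fin (n + 1)) : Fin (k + 1) :=
  ⟨(i : ℕ) * (k + 1) / (n + 1), by
    rw [Nat.div_lt_iff_lt_mul (by omega), mul_comm]
    exact Nat.mul_lt_mul_of_pos_left i.2 (by omega)⟩

/-- The first element of a block. -/
def blockStart (n k j : ℕ) : ℕ := (j * (n + 1) + k) / (k + 1)

/-- `blockStart n k j` is the ceiling of `j * (n + 1) / (k + 1)`; this adjunction replaces
computations with division. -/
lemma blockStart_le_iff {n k j v : ℕ} : blockStart n k j ≤ v ↔ j * (n + 1) ≤ v * (k + 1) := by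
  rw [blockStart, ← Nat.lt_succ_iff, Nat.div_lt_iff_lt_mul (by omega), Nat.succ_mul]
  omega

lemma blockIndex_val_eq_iff {n k j : ℕ} (v : Fin (n + 1)) :
    (blockIndex n k v : ℕ) = j ↔ blockStart n k j ≤ v ∧ v < blockStart n k (j + 1) := by
  rw [← not_le, blockStart_le_iff, blockStart_le_iff, not_le, blockIndex]
  simp only
  rw [Nat.div_eq_iff (by omega), add_mul]
  constructor <;> intro h <;> constructor <;> omega

lemma blockStart_lt {n k j : ℕ} (hkn : k ≤ n) (hj : j ≤ k) : blockStart n k j < n + 1 := by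
  rw [Nat.lt_succ_iff, blockStart_le_iff]
  nlinarith

/-- Ceilings of consecutive multiples of `(n + 1) / (k + 1)` differ by the integer part of this
ratio or by one more. Hence the blocks are balanced. -/
lemma blockStart_succ {n k j : ℕ} :
    blockStart n k (j + 1) = blockStart n k j + (n + 1) / (k + 1) ∨
      blockStart n k (j + 1) = blockStart n k j + ((n + 1) / (k + 1) + 1) := by
  have hr := Nat.div_add_mod (n + 1) (k + 1)
  have hr' := Nat.mod_lt (n + 1) (show k + 1 > 0 by omega)
  set q := (n + 1) / (k + 1)
  set r := (n + 1) % (k + 1)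
  have h1 : blockStart n k (j + 1) ≤ blockStart n k j + (q + 1) := by
    rw [blockStart_le_iff]
    have := (blockStart_le_iff (n := n) (k := k) (j := j)).1 le_rfl
    nlinarith
  have h2 : blockStart n k j + q ≤ blockStart n k (j + 1) := by
    -- This allows writing the next start as `q + d`, so that the claim becomes `blockStart n k j ≤
    -- d` and the adjunction applies.
    have hq : q ≤ blockStart n k (j + 1) := by
      by_contra! h
      have := blockStart_le_iff.1 (Nat.le_sub_one_of_lt h)
      have h3 : (q - 1 + 1) = q := by omega
      nlinarith
    obtain ⟨d, hd⟩ := Nat.exists_eq_add_of_le hq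
    rw [hd, add_comm]
    refine Nat.add_le_add_left ?_ _
    rw [blockStart_le_iff]
    have := blockStart_le_iff.1 hd.le
    nlinarith
  omega

lemma card_block {n k : ℕ} (j : Fin (k + 1)) :
    (Finset.univ.filter fun v => blockIndex n k v = j).card = (n + 1) / (k + 1) ∨
      (Finset.univ.filter fun v => blockIndex n k v = j).card = (n + 1) / (k + 1) + 1 := by
  have hle : blockStart n k (j + 1) ≤ n + 1 := by
    rw [blockStart_le_iff, mul_comm]
    exact Nat.mul_le_mul_left _ j.2
  have h : (Finset.univ.filter fun v => blockIndex n k v = j).card =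
      blockStart n k (j + 1) - blockStart n k j := by
    rw [← Nat.card_Ico]
    refine Finset.card_bij (fun v _ => (v : ℕ)) ?_ ?_ ?_
    · intro v hv
      simpa [Fin.ext_iff, blockIndex_val_eq_iff] using hv
    · intro v _ w _ h
      exact Fin.ext h
    · intro v hv
      rw [Finset.mem_Ico] at hv
      exact ⟨⟨v, by omega⟩, by simpa [Fin.ext_iff, blockIndex_val_eq_iff] using hv, rfl⟩
  rw [h]
  have hs := blockStart_succ (n := n) (k := k) (j := j)
  generalize (n + 1) / (k + 1) = q at hs ⊢
  omega

/-- Since `k ≤ n`, no block is empty, and the first elements of the blocks form the chain. -/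
lemma hasChain_blockRel {n k : ℕ} (hkn : k ≤ n) : HasChain (blockRel n k) k := by
  have hq : 1 ≤ (n + 1) / (k + 1) := (Nat.one_le_div_iff (by omega)).2 (by omega)
  have hidx : ∀ t (ht : t ≤ k),
      (blockIndex n k ⟨blockStart n k t, blockStart_lt hkn ht⟩ : ℕ) = t := by
    intro t ht
    rw [blockIndex_val_eq_iff]
    refine ⟨le_rfl, ?_⟩
    rcases blockStart_succ (n := n) (k := k) (j := t) with h | h <;> rw [h] <;> simp only <;> omega
  refine ⟨fun t => if h : t ≤ k then ⟨blockStart n k t, blockStart_lt hkn h⟩ else 0,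
    fun t ht => ?_⟩
  simp only [ht.le, show t + 1 ≤ k from ht, dif_pos]
  change (blockIndex n k _ : ℕ) < (blockIndex n k _ : ℕ)
  rw [hidx t ht.le, hidx (t + 1) ht]
  omega

lemma not_hasChain_blockRel (n k : ℕ) : ¬ HasChain (blockRel n k) (k + 1) := by
  rintro ⟨c, hc⟩
  have h : ∀ t ≤ k + 1, t ≤ (blockIndex n k (c t) : ℕ) := by
    intro t
    induction t with
    | zero => simp
    | succ t ih => exact fun ht => (ih (by omega)).trans_lt (hc t (by omega))
  have := h (k + 1) le_rfl
  omega

open Classical in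
lemma card_blockRel (n k : ℕ) :
    ((Finset.univ.filter fun p : Fin (n + 1) × Fin (n + 1) => blockRel n k p.1 p.2).card : ℤ) =
      ((n + 1).choose 2 : ℤ) - ((n : ℤ) + 1) * (((n + 1) / (k + 1) : ℕ) : ℤ)
        + ((k : ℤ) + 1) * ((((n + 1) / (k + 1) + 1).choose 2 : ℕ) : ℤ) := by
  have h1 := card_pairs_of_levels (blockIndex n k)
  have h2 : ∀ i j, blockRel n k i j ↔ i < j ∧ blockIndex n k i ≠ blockIndex n k j := by
    intro i j
    refine ⟨fun h => ⟨blockRel_lt h, fun h' => h.ne (congrArg Fin.val h')⟩, fun ⟨h, h'⟩ => ?_⟩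
    refine lt_of_le_of_ne ?_ fun h'' => h' (Fin.ext h'')
    gcongr
    exact h.le
  have h3 := sum_choose_two_eq _ _ (card_block (n := n) (k := k))
  rw [sum_card_fibres] at h3
  simp_rw [h2]
  zify at h1
  push_cast at h1 h3 ⊢
  linarith

/-! ### Lie's theorem and conjugation into upper triangular form -/

open Module LieModule in
/-- A simultaneous triangular form for a solvable Lie algebra of endomorphisms, as a consequence of
Lie's theorem. -/
theorem exists_basis_lie_upperTriangular {L : Type*} [LieRing L] [LieAlgebra ℂ L]
    [LieAlgebra.IsSolvable L] (d : ℕ) {V : Type*} [AddCommGroup V] [Module ℂ V]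
    [FiniteDimensional ℂ V] [LieRingModule L V] [LieModule ℂ L V] (hV : finrank ℂ V = d) :
    ∃ B : Basis (Fin d) ℂ V, ∀ (x : L) (i j : Fin d), j < i → B.repr ⁅x, B j⁆ i = 0 := by
  induction d generalizing V with
  | zero => exact ⟨finBasisOfFinrankEq ℂ V hV, fun _ i => i.elim0⟩
  | succ d ih =>
    have : Nontrivial V := nontrivial_of_finrank_pos (R := ℂ) (by omega)
    -- A common eigenvector in the dual space has as kernel an invariant hyperplane, to which the
    -- induction applies.
    obtain ⟨χ, hχ⟩ := exists_nontrivial_weightSpace_of_isSolvable ℂ L (V →ₗ[ℂ] ℂ)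
    obtain ⟨⟨f, hf⟩, hf0⟩ := exists_ne (0 : weightSpace (V →ₗ[ℂ] ℂ) χ)
    rw [mem_weightSpace] at hf
    have hf0 : f ≠ 0 := fun h => hf0 (Subtype.ext h)
    have hfx : ∀ (x : L) (v : V), f ⁅x, v⁆ = -(χ x * f v) := by
      intro x v
      have h := congrArg (fun g : V →ₗ[ℂ] ℂ => g v) (hf x)
      simp only [Module.Dual.lie_apply, LinearMap.smul_apply, smul_eq_mul] at h
      rw [← h, neg_neg]
    let W : LieSubmodule ℂ L V :=
      { LinearMap.ker f with
        lie_mem := fun {x v} hv => by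
          have hv' : f v = 0 := hv
          change f ⁅x, v⁆ = 0
          rw [hfx, hv', mul_zero, neg_zero] }
    have hW : finrank ℂ W = d := by
      have h1 := f.finrank_range_add_finrank_ker
      rw [LinearMap.range_eq_top.2 (LinearMap.surjective hf0), finrank_top, finrank_self, hV] at h1
      change finrank ℂ (LinearMap.ker f) = d
      omega
    obtain ⟨B, hB⟩ := ih hW
    obtain ⟨y, hy⟩ : ∃ y, f y ≠ 0 := by
      by_contra! h
      exact hf0 (LinearMap.ext h)
    have hli : ∀ (c : ℂ), ∀ x ∈ LinearMap.ker f, c • y + x = 0 → c = 0 := by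
      intro c x hx h
      have := congrArg f h
      simpa [LinearMap.mem_ker.1 hx, hy] using this
    have hsp : ∀ z : V, ∃ c : ℂ, z + c • y ∈ LinearMap.ker f := fun z =>
      ⟨-(f z / f y), by simp [hy]⟩
    let B' : Basis (Fin d) ℂ (LinearMap.ker f) := B
    -- The vector outside the hyperplane comes last, where the triangular condition on its column is
    -- empty.
    refine ⟨Basis.mkFinSnoc B' y hli hsp, ?_⟩
    set C := Basis.mkFinSnoc B' y hli hsp with hC
    have hcast : ∀ i : Fin d, C i.castSucc = (B i : V) := fun i => by
      rw [hC, Basis.coe_mkFinSnoc, Fin.snoc_castSucc]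
      rfl
    have hrepr : ∀ w : W, ∀ i : Fin d, C.repr (w : V) i.castSucc = B.repr w i := by
      intro w i
      have h : C.coord i.castSucc ∘ₗ W.toSubmodule.subtype = B.coord i := by
        refine B.ext fun j => ?_
        change C.repr (B j : V) i.castSucc = B.coord i (B j)
        rw [← hcast]
        simp [Finsupp.single_apply]
      exact LinearMap.congr_fun h w
    have hlast : ∀ w : W, C.repr (w : V) (Fin.last d) = 0 := by
      intro w
      have h : C.coord (Fin.last d) ∘ₗ W.toSubmodule.subtype = 0 := by
        refine B.ext fun j => ?_
        change C.repr (B j : V) (Fin.last d) = 0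
        rw [← hcast]
        simp
      exact LinearMap.congr_fun h w
    intro x i j hji
    induction j using Fin.lastCases with
    | last => exact absurd hji (Fin.le_last i).not_gt
    | cast j =>
      have h : ⁅x, C j.castSucc⁆ = ((⁅x, B j⁆ : W) : V) := by
        rw [hcast, LieSubmodule.coe_bracket]
      rw [h]
      induction i using Fin.lastCases with
      | last => exact hlast _
      | cast i => rw [hrepr]; exact hB x i j (by simpa using hji)

/-- The subalgebra of upper triangular matrices in `sl(n+1, ℂ)`. -/
def upperBorel (n : ℕ) : LieSubalgebra ℂ (SL n) where
  carrier := {x | ∀ i j, j < i → (x : Matrix (Fin (n + 1)) (Fin (n + 1)) ℂ) i j = 0}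
  add_mem' := fun {x y} hx hy i j h => by simp [hx i j h, hy i j h]
  zero_mem' := fun i j _ => rfl
  smul_mem' := fun c x hx i j h => by simp [hx i j h]
  lie_mem' := fun {x y} hx hy i j h => by
    rw [LieAlgebra.SpecialLinear.sl_bracket]
    simp only [Matrix.sub_apply, Matrix.mul_apply]
    rw [Finset.sum_eq_zero, Finset.sum_eq_zero, sub_zero]
    · intro l _
      rcases lt_or_ge l i with h' | h'
      · rw [hy i l h', zero_mul]
      · rw [hx l j (h.trans_le h'), mul_zero]
    · intro l _
      rcases lt_or_ge l i with h' | h'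
      · rw [hx i l h', zero_mul]
      · rw [hy l j (h.trans_le h'), mul_zero]

lemma mem_upperBorel {n : ℕ} {x : SL n} : x ∈ upperBorel n ↔
    ∀ i j, j < i → (x : Matrix (Fin (n + 1)) (Fin (n + 1)) ℂ) i j = 0 := Iff.rfl

lemma mem_SL {n : ℕ} {x : Matrix (Fin (n + 1)) (Fin (n + 1)) ℂ} : x ∈ SL n ↔ x.trace = 0 := Iff.rfl

/-- The automorphism of `sl(n+1, ℂ)` given by conjugation with an invertible matrix. -/
noncomputable def conjSL {n : ℕ} (P : Matrix (Fin (n + 1)) (Fin (n + 1)) ℂ) (hP : Invertible P) :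
    SL n ≃ₗ⁅ℂ⁆ SL n :=
  LieEquiv.ofSubalgebras (SL n) (SL n) (P.lieConj hP) <| by
    ext x
    rw [LieSubalgebra.mem_map, mem_SL]
    constructor
    · rintro ⟨y, hy, rfl⟩
      rw [mem_SL] at hy
      rw [LieEquiv.coe_toLieHom, Matrix.lieConj_apply, Matrix.trace_mul_comm, ← mul_assoc,
        Matrix.inv_mul_of_invertible, one_mul, hy]
    · intro hx
      refine ⟨P⁻¹ * x * P, ?_, by simp [Matrix.mul_assoc]⟩
      rw [mem_SL, Matrix.trace_mul_comm, ← mul_assoc, Matrix.mul_inv_of_invertible, one_mul, hx]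

lemma coe_conjSL {n : ℕ} (P : Matrix (Fin (n + 1)) (Fin (n + 1)) ℂ) (hP : Invertible P)
    (x : SL n) : (conjSL P hP x : Matrix (Fin (n + 1)) (Fin (n + 1)) ℂ) = P * x * P⁻¹ := by
  rw [← Matrix.lieConj_apply (h := hP)]
  rfl

/-- A solvable subalgebra of `sl(n+1, ℂ)` is conjugate to a subalgebra of the upper triangular
matrices. -/
theorem exists_conj_mem_upperBorel {n : ℕ} (b : LieSubalgebra ℂ (SL n))
    [LieAlgebra.IsSolvable b] : ∃ e : SL n ≃ₗ⁅ℂ⁆ SL n, ∀ x ∈ b, e x ∈ upperBorel n := by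
  obtain ⟨B, hB⟩ := exists_basis_lie_upperTriangular (L := b) (n + 1) (V := Fin (n + 1) → ℂ)
    (by simp)
  -- Conjugation by `Q` turns a matrix into the matrix of the same endomorphism in the basis `B`.
  let Q := B.toMatrix (Pi.basisFun ℂ (Fin (n + 1)))
  let Q' := (Pi.basisFun ℂ (Fin (n + 1))).toMatrix B
  have h1 : Q * Q' = 1 := B.toMatrix_mul_toMatrix_flip _
  have h2 : Q' * Q = 1 := Module.Basis.toMatrix_mul_toMatrix_flip _ _
  let hQ : Invertible Q := ⟨Q', h2, h1⟩
  refine ⟨conjSL Q hQ, fun x hx => ?_⟩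
  rw [mem_upperBorel]
  intro i j hij
  rw [coe_conjSL, Matrix.inv_eq_left_inv h2]
  have h := hB ⟨x, hx⟩ i j hij
  have h3 : ⁅(⟨x, hx⟩ : b), B j⁆ = (x : Matrix (Fin (n + 1)) (Fin (n + 1)) ℂ).mulVec (B j) := rfl
  rw [h3] at h
  have h4 : Q * (x : Matrix (Fin (n + 1)) (Fin (n + 1)) ℂ) * Q' =
      LinearMap.toMatrix B B (Matrix.toLin' (x : Matrix (Fin (n + 1)) (Fin (n + 1)) ℂ)) := by
    rw [← basis_toMatrix_mul_linearMap_toMatrix_mul_basis_toMatrix B (Pi.basisFun ℂ _) B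
      (Pi.basisFun ℂ _), LinearMap.toMatrix_eq_toMatrix', LinearMap.toMatrix'_toLin']
  rw [h4, LinearMap.toMatrix_apply, Matrix.toLin'_apply, h]

/-! ### Invariance under isomorphism -/

/-- Conjugate subalgebras have ad-nilpotent ideals of the same dimensions. -/
theorem adNilpotentDims_subset_of_equiv {L L' : Type*} [LieRing L] [LieAlgebra ℂ L] [LieRing L']
    [LieAlgebra ℂ L'] (e : L ≃ₗ⁅ℂ⁆ L') {b : LieSubalgebra ℂ L} {b' : LieSubalgebra ℂ L'}
    (h : b.map (e : L →ₗ⁅ℂ⁆ L') = b') (k : ℕ) : adNilpotentDims b k ⊆ adNilpotentDims b' k := by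
  rintro d ⟨I, hI, hk, rfl⟩
  let f := e.ofSubalgebras b b' h
  have hf : Function.Surjective (f : b →ₗ⁅ℂ⁆ b') := f.surjective
  have hbot : ∀ J : LieIdeal ℂ b, J.map (f : b →ₗ⁅ℂ⁆ b') = ⊥ ↔ J = ⊥ := by
    intro J
    rw [LieIdeal.map_eq_bot_iff, (LieHom.ker_eq_bot _).2 f.injective, le_bot_iff]
  have hiter : ∀ m, iterBracket (I.map (f : b →ₗ⁅ℂ⁆ b')) m =
      (iterBracket I m).map (f : b →ₗ⁅ℂ⁆ b') := by
    intro m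
    induction m with
    | zero => rfl
    | succ m ih => rw [iterBracket, iterBracket, ih, LieIdeal.map_bracket_eq _ hf]
  refine ⟨I.map (f : b →ₗ⁅ℂ⁆ b'), ?_, ?_, ?_⟩
  · intro y hy
    obtain ⟨x, rfl⟩ := LieIdeal.mem_map_of_surjective hf hy
    have hx : ((f : b →ₗ⁅ℂ⁆ b') (x : b) : L') = e (x : b) := rfl
    rw [hx, ← LieAlgebra.conj_ad_apply, LinearEquiv.conj_apply]
    have := (hI x x.2).map e.toLinearEquiv.conjRingEquiv
    exact this
  · unfold HasNilpotenceClass at hk ⊢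
    simp_rw [hiter, hbot]
    exact hk
  · have h1 : (I.map (f : b →ₗ⁅ℂ⁆ b')).toSubmodule =
        I.toSubmodule.map (f.toLinearEquiv : b →ₗ[ℂ] b') := LieIdeal.coe_map_of_surjective hf
    have h2 := LinearEquiv.finrank_map_eq f.toLinearEquiv I.toSubmodule
    rw [← h1] at h2
    exact_mod_cast h2

theorem adNilpotentDims_eq_of_equiv {L L' : Type*} [LieRing L] [LieAlgebra ℂ L] [LieRing L']
    [LieAlgebra ℂ L'] (e : L ≃ₗ⁅ℂ⁆ L') {b : LieSubalgebra ℂ L} {b' : LieSubalgebra ℂ L'}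
    (h : b.map (e : L →ₗ⁅ℂ⁆ L') = b') (k : ℕ) : adNilpotentDims b k = adNilpotentDims b' k := by
  refine (adNilpotentDims_subset_of_equiv e h k).antisymm
    (adNilpotentDims_subset_of_equiv e.symm ?_ k)
  ext x
  simp [← h]

/-! ### Matrix units and diagonal elements -/

/-- The matrix entries of an element of the upper triangular Borel subalgebra. -/
def entry {n : ℕ} (x : upperBorel n) : Matrix (Fin (n + 1)) (Fin (n + 1)) ℂ := ((x : SL n) : Matrix _ _ ℂ)

lemma entry_of_lt {n : ℕ} (x : upperBorel n) {i j : Fin (n + 1)} (h : j < i) : entry x i j = 0 :=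
  x.2 i j h

lemma entry_injective {n : ℕ} : Function.Injective (entry (n := n)) := fun _ _ h =>
  Subtype.ext (Subtype.ext h)

@[simp] lemma entry_add {n : ℕ} (x y : upperBorel n) : entry (x + y) = entry x + entry y := rfl

@[simp] lemma entry_zero {n : ℕ} : entry (0 : upperBorel n) = 0 := rfl

@[simp] lemma entry_smul {n : ℕ} (c : ℂ) (x : upperBorel n) : entry (c • x) = c • entry x := rfl

lemma entry_lie {n : ℕ} (x y : upperBorel n) :
    entry ⁅x, y⁆ = entry x * entry y - entry y * entry x := rfl

/-- The linear map sending an upper triangular element to its matrix. -/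
def entryHom {n : ℕ} : upperBorel n →ₗ[ℂ] Matrix (Fin (n + 1)) (Fin (n + 1)) ℂ where
  toFun := entry
  map_add' := entry_add
  map_smul' := entry_smul

/-- The element of the Borel subalgebra with prescribed matrix. -/
def mkUpper {n : ℕ} (x : Matrix (Fin (n + 1)) (Fin (n + 1)) ℂ) (ht : x.trace = 0)
    (hx : ∀ i j, j < i → x i j = 0) : upperBorel n := ⟨⟨x, ht⟩, hx⟩

/-- The matrix units strictly above the diagonal. -/
def unitUpper {n : ℕ} (i j : Fin (n + 1)) (h : i < j) : upperBorel n :=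
  mkUpper (Matrix.single i j 1) (Matrix.trace_single_eq_of_ne _ _ _ h.ne) fun a b hab => by
    rw [Matrix.single_apply_of_ne]
    rintro ⟨rfl, rfl⟩
    exact h.not_gt hab

@[simp] lemma entry_unitUpper {n : ℕ} {i j : Fin (n + 1)} (h : i < j) :
    entry (unitUpper i j h) = Matrix.single i j 1 := rfl

/-- The traceless diagonal matrix acting by the bracket like a diagonal matrix unit. -/
noncomputable def diagUpper {n : ℕ} (i : Fin (n + 1)) : upperBorel n :=
  mkUpper (Matrix.single i i 1 - ((n : ℂ) + 1)⁻¹ • 1) (by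
    have : (n : ℂ) + 1 ≠ 0 := by exact_mod_cast n.succ_ne_zero
    simp [this]) fun a b hab => by
      rw [Matrix.sub_apply, Matrix.single_apply_of_ne, Matrix.smul_apply, Matrix.one_apply_ne hab.ne']
      · simp
      · rintro ⟨rfl, rfl⟩
        exact lt_irrefl _ hab

/-- The scalar correction making `diagUpper i` traceless is central and drops out of the bracket. -/
lemma entry_lie_diagUpper {n : ℕ} (i : Fin (n + 1)) (x : upperBorel n) (a b : Fin (n + 1)) :
    entry ⁅diagUpper i, x⁆ a b =
      ((if a = i then 1 else 0) - (if b = i then 1 else 0)) * entry x a b := by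
  have h : entry (diagUpper i) = Matrix.single i i 1 - ((n : ℂ) + 1)⁻¹ • 1 := rfl
  have h1 : (Matrix.single i i (1 : ℂ) : Matrix (Fin (n + 1)) (Fin (n + 1)) ℂ) =
      Matrix.diagonal fun a => if a = i then 1 else 0 := by
    ext a b
    by_cases hab : a = b
    · subst hab
      simp [Matrix.single_apply, eq_comm]
    · rw [Matrix.diagonal_apply_ne _ hab, Matrix.single_apply_of_ne]
      rintro ⟨rfl, rfl⟩
      exact hab rfl
  rw [entry_lie, h, sub_mul, mul_sub, smul_mul_assoc, one_mul, mul_smul_comm, mul_one,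
    sub_sub_sub_cancel_right, h1, Matrix.sub_apply, Matrix.diagonal_mul, Matrix.mul_diagonal]
  ring

/-- A matrix unit occurring in an element is isolated by two brackets with diagonal elements. -/
lemma lie_lie_diagUpper {n : ℕ} {i j : Fin (n + 1)} (hij : i < j) (x : upperBorel n) :
    ⁅diagUpper j, ⁅diagUpper i, x⁆⁆ = (-entry x i j) • unitUpper i j hij := by
  apply entry_injective
  ext a b
  rw [entry_lie_diagUpper, entry_lie_diagUpper, entry_smul, Matrix.smul_apply, entry_unitUpper,
    Matrix.single_apply]
  -- The product of the two weights vanishes except at `(i, j)`, where it is `-1`, and at `(j, i)`,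
  -- where `x` has no entry.
  by_cases h1 : a = i
  · subst h1
    by_cases h2 : b = j
    · subst h2
      simp [hij.ne, hij.ne']
    · simp [h2, hij.ne, Ne.symm h2]
  · by_cases h2 : a = j
    · subst h2
      by_cases h3 : b = i
      · subst h3
        simp [entry_of_lt x hij, hij.ne]
      · simp [h1, h3, Ne.symm h1]
    · simp [h1, h2, Ne.symm h1]
      rintro rfl rfl
      exact absurd hij (lt_irrefl _)

lemma lie_unitUpper {n : ℕ} {i j l : Fin (n + 1)} (hij : i < j) (hjl : j < l) :
    ⁅unitUpper i j hij, unitUpper j l hjl⁆ = unitUpper i l (hij.trans hjl) := by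
  apply entry_injective
  rw [entry_lie, entry_unitUpper, entry_unitUpper, entry_unitUpper, Matrix.single_mul_single_same,
    Matrix.single_mul_single_of_ne _ _ _ _ (hij.trans hjl).ne', sub_zero, one_mul]

lemma eq_sum_unitUpper {n : ℕ} (x : upperBorel n) (hx : ∀ i, entry x i i = 0) :
    x = ∑ p : Fin (n + 1) × Fin (n + 1),
      if h : p.1 < p.2 then entry x p.1 p.2 • unitUpper p.1 p.2 h else 0 := by
  apply entry_injective
  change _ = entryHom _
  rw [map_sum, Fintype.sum_prod_type]
  conv_lhs => rw [Matrix.matrix_eq_sum_single (entry x)]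
  refine Finset.sum_congr rfl fun i _ => Finset.sum_congr rfl fun j _ => ?_
  dsimp only
  split_ifs with h
  · rw [map_smul]
    change _ = _ • Matrix.single i j (1 : ℂ)
    rw [Matrix.smul_single, smul_eq_mul, mul_one]
  · rw [map_zero]
    have : entry x i j = 0 := by
      rcases (not_lt.1 h).eq_or_lt with h' | h'
      · rw [h', hx]
      · exact entry_of_lt x h'
    rw [this, Matrix.single_zero]

/-! ### Ideals supported on a relation and their nilpotence class -/

/-- The ideal of upper triangular matrices supported on a relation. -/
def relIdeal {n : ℕ} (S : Fin (n + 1) → Fin (n + 1) → Prop) (hS : UpClosed S) :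
    LieIdeal ℂ (upperBorel n) where
  carrier := {x | ∀ i j, ¬ S i j → entry x i j = 0}
  add_mem' := fun {x y} hx hy i j h => by simp [hx i j h, hy i j h]
  zero_mem' := fun i j _ => rfl
  smul_mem' := fun c x hx i j h => by simp [hx i j h]
  lie_mem := fun {x y} hy i j h => by
    rw [entry_lie, Matrix.sub_apply, Matrix.mul_apply, Matrix.mul_apply,
      Finset.sum_eq_zero, Finset.sum_eq_zero, sub_zero]
    · intro l _
      rcases le_or_gt l j with h' | h'
      · rw [hy i l fun h'' => h (hS le_rfl h' h''), zero_mul]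
      · rw [entry_of_lt x h', mul_zero]
    · intro l _
      rcases le_or_gt i l with h' | h'
      · rw [hy l j fun h'' => h (hS h' le_rfl h''), mul_zero]
      · rw [entry_of_lt x h', zero_mul]

lemma mem_relIdeal {n : ℕ} {S : Fin (n + 1) → Fin (n + 1) → Prop} {hS : UpClosed S}
    {x : upperBorel n} : x ∈ relIdeal S hS ↔ ∀ i j, ¬ S i j → entry x i j = 0 := Iff.rfl

lemma unitUpper_mem_relIdeal {n : ℕ} {S : Fin (n + 1) → Fin (n + 1) → Prop} {hS : UpClosed S}
    {i j : Fin (n + 1)} (hij : i < j) (h : S i j) : unitUpper i j hij ∈ relIdeal S hS := by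
  intro a b hab
  rw [entry_unitUpper, Matrix.single_apply_of_ne]
  rintro ⟨rfl, rfl⟩
  exact hab h

open Classical in
lemma finrank_relIdeal {n : ℕ} {S : Fin (n + 1) → Fin (n + 1) → Prop} (hS : UpClosed S)
    (hlt : ∀ i j, S i j → i < j) : Module.finrank ℂ (relIdeal S hS) =
      (Finset.univ.filter fun p : Fin (n + 1) × Fin (n + 1) => S p.1 p.2).card := by
  let e : relIdeal S hS ≃ₗ[ℂ] ({p : Fin (n + 1) × Fin (n + 1) // S p.1 p.2} → ℂ) :=
    { toFun := fun x p => entry x.1 p.1.1 p.1.2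
      map_add' := fun x y => rfl
      map_smul' := fun c x => rfl
      invFun := fun g => ⟨mkUpper (Matrix.of fun i j => if h : S i j then g ⟨(i, j), h⟩ else 0)
        (Finset.sum_eq_zero fun i _ => dif_neg fun h => lt_irrefl _ (hlt i i h))
        fun i j hij => dif_neg fun h => (hlt i j h).not_gt hij, fun i j hij => by
          change (if h : S i j then g ⟨(i, j), h⟩ else 0) = 0
          rw [dif_neg hij]⟩
      left_inv := fun x => by
        apply Subtype.ext
        apply entry_injective
        ext i j
        change (if h : S i j then entry x.1 i j else 0) = _
        split_ifs with h
        · rfl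
        · exact (x.2 i j h).symm
      right_inv := fun g => by
        ext ⟨⟨i, j⟩, h⟩
        change (if h : S i j then g ⟨(i, j), h⟩ else 0) = _
        rw [dif_pos h] }
  rw [e.finrank_eq, Module.finrank_fintype_fun_eq_card, Fintype.card_subtype]

/-- `(i, j)` is joined by a chain of `m + 1` pairs of `S`. -/
def ChainRel {N : ℕ} (S : Fin N → Fin N → Prop) : ℕ → Fin N → Fin N → Prop
  | 0 => S
  | m + 1 => fun i l => ∃ j, S i j ∧ ChainRel S m j l

lemma ChainRel.upClosed {N : ℕ} {S : Fin N → Fin N → Prop} (hS : UpClosed S) (m : ℕ) :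
    UpClosed (ChainRel S m) := by
  induction m with
  | zero => exact hS
  | succ m ih =>
    rintro a i j b hai hjb ⟨l, h1, h2⟩
    exact ⟨l, hS hai le_rfl h1, ih le_rfl hjb h2⟩

/-- `ChainRel` grows at its left end; growth at the right end is needed for the second product in a
commutator. -/
lemma ChainRel.snoc {N : ℕ} {S : Fin N → Fin N → Prop} {m : ℕ} {i j l : Fin N}
    (h : ChainRel S m i j) (h' : S j l) : ChainRel S (m + 1) i l := by
  induction m generalizing i with
  | zero => exact ⟨j, h, h'⟩
  | succ m ih =>
    obtain ⟨a, h1, h2⟩ := h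
    exact ⟨a, h1, ih h2⟩

lemma ChainRel.exists_chain {N : ℕ} {S : Fin N → Fin N → Prop} {m : ℕ} {i j : Fin N}
    (h : ChainRel S m i j) : ∃ c : ℕ → Fin N, c 0 = i ∧ ∀ t < m + 1, S (c t) (c (t + 1)) := by
  induction m generalizing i with
  | zero =>
    refine ⟨fun t => if t = 0 then i else j, by simp, fun t ht => ?_⟩
    obtain rfl : t = 0 := by omega
    exact h
  | succ m ih =>
    obtain ⟨a, h1, h2⟩ := h
    obtain ⟨c, hc0, hc⟩ := ih h2
    refine ⟨fun t => t.casesOn i c, rfl, fun t ht => ?_⟩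
    cases t with
    | zero => change S i (c 0); rw [hc0]; exact h1
    | succ t => exact hc t (by omega)

lemma iterBracket_relIdeal_le {n : ℕ} {S : Fin (n + 1) → Fin (n + 1) → Prop} (hS : UpClosed S)
    (m : ℕ) : iterBracket (relIdeal S hS) m ≤ relIdeal (ChainRel S m) (ChainRel.upClosed hS m) := by
  induction m with
  | zero => exact le_rfl
  | succ m ih =>
    rw [iterBracket, LieSubmodule.lie_le_iff]
    intro x hx y hy
    replace hy := ih hy
    rw [mem_relIdeal] at *
    intro i j hij
    rw [entry_lie, Matrix.sub_apply, Matrix.mul_apply, Matrix.mul_apply,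
      Finset.sum_eq_zero, Finset.sum_eq_zero, sub_zero]
    · intro l _
      by_cases h : ChainRel S m i l
      · rw [hx l j fun h' => hij (h.snoc h'), mul_zero]
      · rw [hy i l h, zero_mul]
    · intro l _
      by_cases h : S i l
      · rw [hy l j fun h' => hij ⟨l, h, h'⟩, mul_zero]
      · rw [hx i l h, zero_mul]

/-- Bracketing the units along the chain, from its right end, telescopes to the unit joining its two
ends. -/
lemma unitUpper_mem_iterBracket {n m : ℕ} {S : Fin (n + 1) → Fin (n + 1) → Prop} (hS : UpClosed S)
    (hlt : ∀ i j, S i j → i < j) {c : ℕ → Fin (n + 1)} (hc : ∀ t < m + 1, S (c t) (c (t + 1))) :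
    unitUpper (c 0) (c (m + 1)) (strictMonoOn_of_chain hlt hc (Nat.succ_pos m) le_rfl) ∈
      iterBracket (relIdeal S hS) m := by
  induction m generalizing c with
  | zero => exact unitUpper_mem_relIdeal _ (hc 0 (by omega))
  | succ m ih =>
    have h1 : S (c 0) (c 1) := hc 0 (by omega)
    have h2 := ih (c := fun t => c (t + 1)) fun t ht => hc (t + 1) (by omega)
    rw [iterBracket, ← lie_unitUpper (hlt _ _ h1)
      (strictMonoOn_of_chain hlt hc (show 1 < m + 1 + 1 by omega) le_rfl)]
    exact LieSubmodule.lie_mem_lie (unitUpper_mem_relIdeal _ h1) h2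

lemma unitUpper_ne_zero {n : ℕ} {i j : Fin (n + 1)} (h : i < j) : unitUpper i j h ≠ 0 := by
  intro h'
  have := congrFun (congrFun (congrArg entry h') i) j
  simp at this

lemma iterBracket_relIdeal_eq_bot_iff {n m : ℕ} {S : Fin (n + 1) → Fin (n + 1) → Prop}
    (hS : UpClosed S) (hlt : ∀ i j, S i j → i < j) :
    iterBracket (relIdeal S hS) m = ⊥ ↔ ¬ HasChain S (m + 1) := by
  constructor
  · rintro h ⟨c, hc⟩
    have := unitUpper_mem_iterBracket hS hlt hc
    rw [h, LieSubmodule.mem_bot] at this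
    exact unitUpper_ne_zero _ this
  · intro h
    rw [eq_bot_iff]
    intro x hx
    rw [LieSubmodule.mem_bot]
    apply entry_injective
    ext i j
    exact iterBracket_relIdeal_le hS m hx i j fun h' =>
      h (h'.exists_chain.imp fun _ hc => hc.2)

/-- Vanishing after `m` brackets means that no chain of `m + 1` pairs exists. As chains can be
shortened, minimality of `k` amounts to a chain of `k` pairs, which is automatic for `k = 0`. -/
lemma hasNilpotenceClass_relIdeal_iff {n k : ℕ} {S : Fin (n + 1) → Fin (n + 1) → Prop}
    (hS : UpClosed S) (hlt : ∀ i j, S i j → i < j) :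
    HasNilpotenceClass (relIdeal S hS) k ↔ HasChain S k ∧ ¬ HasChain S (k + 1) := by
  simp only [HasNilpotenceClass, IsLeast, lowerBounds, Set.mem_ofPred_eq,
    iterBracket_relIdeal_eq_bot_iff hS hlt]
  rw [and_comm]
  refine and_congr_left fun _ => ⟨fun h => ?_, fun h m hm => ?_⟩
  · cases k with
    | zero => exact hasChain_zero S
    | succ k =>
      by_contra h'
      have := h h'
      omega
  · by_contra! h'
    exact hm (h.mono h')

/-! ### Solvability and ad-nilpotency -/

/-- The `m`-th derived ideal is supported at distance at least `m` above the diagonal. -/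
theorem isSolvable_upperBorel (n : ℕ) : LieAlgebra.IsSolvable (upperBorel n) := by
  let R : ℕ → Fin (n + 1) → Fin (n + 1) → Prop := fun m i j => (i : ℕ) + m ≤ j
  have hR : ∀ m, UpClosed (R m) := fun m a i j b hai hjb h => by
    simp only [R, Fin.le_def] at *
    omega
  have hlie : ∀ m, ⁅relIdeal (R m) (hR m), relIdeal (R m) (hR m)⁆ ≤
      relIdeal (R (m + 1)) (hR (m + 1)) := by
    intro m
    rw [LieSubmodule.lie_le_iff]
    intro x hx y hy
    rw [mem_relIdeal] at *
    intro i j hij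
    rw [entry_lie, Matrix.sub_apply, Matrix.mul_apply, Matrix.mul_apply, ← Finset.sum_sub_distrib]
    refine Finset.sum_eq_zero fun l _ => ?_
    -- Both factors can contribute only if `m = 0` and `i = l = j`, where the diagonal products
    -- cancel in the commutator.
    by_cases h1 : R m i l ∧ R m l j
    · obtain rfl : i = l := by simp only [R, Fin.ext_iff] at *; omega
      obtain rfl : i = j := by simp only [R, Fin.ext_iff] at *; omega
      ring
    · rw [not_and_or] at h1
      rcases h1 with h1 | h1
      · rw [hx i l h1, hy i l h1]; ring
      · rw [hx l j h1, hy l j h1]; ring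
  have hder : ∀ m, LieAlgebra.derivedSeries ℂ (upperBorel n) m ≤ relIdeal (R m) (hR m) := by
    intro m
    induction m with
    | zero =>
      intro x _ i j hij
      exact entry_of_lt x (by simp only [R, Fin.lt_def] at *; omega)
    | succ m ih =>
      rw [LieAlgebra.derivedSeries_def, LieAlgebra.derivedSeriesOfIdeal_succ]
      exact (LieSubmodule.mono_lie ih ih).trans (hlie m)
  refine LieAlgebra.IsSolvable.mk (R := ℂ) (k := n + 1) (eq_bot_iff.2 fun x hx => ?_)
  rw [LieSubmodule.mem_bot]
  apply entry_injective
  ext i j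
  exact hder _ hx i j (by simp only [R]; omega)

lemma isNilpotent_of_strictly_upper {N : ℕ} {x : Matrix (Fin N) (Fin N) ℂ}
    (hx : ∀ i j, j ≤ i → x i j = 0) : IsNilpotent x := by
  have h : ∀ m (i j : Fin N), (j : ℕ) < i + m → (x ^ m) i j = 0 := by
    intro m
    induction m with
    | zero => exact fun i j hij => Matrix.one_apply_ne (by rintro rfl; omega)
    | succ m ih =>
      intro i j hij
      rw [pow_succ, Matrix.mul_apply]
      refine Finset.sum_eq_zero fun l _ => ?_
      rcases lt_or_ge (l : ℕ) (i + m) with h | h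
      · rw [ih i l h, zero_mul]
      · rw [hx l j (by rw [Fin.le_def]; omega), mul_zero]
  exact ⟨N, Matrix.ext fun i j => h N i j (by omega)⟩

/-- Strictly upper triangular matrices are nilpotent, hence ad-nilpotent on all matrices, and this
restricts to `SL n`. -/
lemma isAdNilpotentIdeal_relIdeal {n : ℕ} {S : Fin (n + 1) → Fin (n + 1) → Prop} (hS : UpClosed S)
    (hlt : ∀ i j, S i j → i < j) : IsAdNilpotentIdeal (relIdeal S hS) := by
  intro x hx
  apply LieSubalgebra.isNilpotent_ad_of_isNilpotent_ad
  apply LieAlgebra.ad_nilpotent_of_nilpotent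
  exact isNilpotent_of_strictly_upper fun i j hij => hx i j fun h => (hlt i j h).not_ge hij

/-- The diagonal of an ad-nilpotent upper triangular matrix of trace zero vanishes. -/
lemma entry_diag_eq_zero {n : ℕ} {x : upperBorel n}
    (hx : IsNilpotent (LieAlgebra.ad ℂ (SL n) (x : SL n))) (i : Fin (n + 1)) : entry x i i = 0 := by
  have key : ∀ i j, i < j → entry x i i = entry x j j := by
    intro i j hij
    -- Powers of `ad x` keep the unit at `(i, j)` supported above and to the right of that position,
    -- and its coefficient there is an eigenvalue power. Nilpotency forces the eigenvalue, a
    -- difference of diagonal entries, to vanish.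
    have h : ∀ m, (∀ a b, ¬ (a ≤ i ∧ j ≤ b) →
        (((LieAlgebra.ad ℂ (SL n) (x : SL n)) ^ m) (unitUpper i j hij : SL n) :
          Matrix (Fin (n + 1)) (Fin (n + 1)) ℂ) a b = 0) ∧
        (((LieAlgebra.ad ℂ (SL n) (x : SL n)) ^ m) (unitUpper i j hij : SL n) :
          Matrix (Fin (n + 1)) (Fin (n + 1)) ℂ) i j = (entry x i i - entry x j j) ^ m := by
      intro m
      induction m with
      | zero =>
        constructor
        · intro a b hab
          change entry (unitUpper i j hij) a b = 0
          rw [entry_unitUpper, Matrix.single_apply_of_ne]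
          rintro ⟨rfl, rfl⟩
          exact hab ⟨le_rfl, le_rfl⟩
        · change entry (unitUpper i j hij) i j = _
          simp
      | succ m ih =>
        obtain ⟨ih1, ih2⟩ := ih
        rw [pow_succ', Module.End.mul_apply, LieAlgebra.ad_apply, LieAlgebra.SpecialLinear.sl_bracket]
        set y : Matrix (Fin (n + 1)) (Fin (n + 1)) ℂ :=
          (((LieAlgebra.ad ℂ (SL n) (x : SL n)) ^ m) (unitUpper i j hij : SL n)).val
        change (∀ a b, ¬ (a ≤ i ∧ j ≤ b) → (entry x * y - y * entry x) a b = 0) ∧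
          (entry x * y - y * entry x) i j = _
        constructor
        · intro a b hab
          rw [Matrix.sub_apply, Matrix.mul_apply, Matrix.mul_apply,
            Finset.sum_eq_zero, Finset.sum_eq_zero, sub_zero]
          · intro l _
            rcases le_or_gt l b with h | h
            · rw [ih1 a l fun h' => hab ⟨h'.1, h'.2.trans h⟩, zero_mul]
            · rw [entry_of_lt x h, mul_zero]
          · intro l _
            rcases le_or_gt a l with h | h
            · rw [ih1 l b fun h' => hab ⟨h.trans h'.1, h'.2⟩, mul_zero]
            · rw [entry_of_lt x h, zero_mul]
        · rw [Matrix.sub_apply, Matrix.mul_apply, Matrix.mul_apply, Finset.sum_eq_single i,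
            Finset.sum_eq_single j, ih2]
          · ring
          · intro l _ hl
            rcases lt_or_ge l j with h | h
            · rw [ih1 i l fun h' => h.not_ge h'.2, zero_mul]
            · rw [entry_of_lt x (lt_of_le_of_ne h hl.symm), mul_zero]
          · simp
          · intro l _ hl
            rcases lt_or_ge i l with h | h
            · rw [ih1 l j fun h' => h.not_ge h'.1, mul_zero]
            · rw [entry_of_lt x (lt_of_le_of_ne h hl), zero_mul]
          · simp
    obtain ⟨m, hm⟩ := hx
    have h1 := (h m).2
    rw [hm] at h1
    exact sub_eq_zero.1 (eq_zero_of_pow_eq_zero h1.symm)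
  have hall : ∀ j, entry x j j = entry x i i := by
    intro j
    rcases lt_trichotomy i j with h | h | h
    · exact (key i j h).symm
    · rw [h]
    · exact key j i h
  have htr : ∑ j, entry x j j = 0 := (x : SL n).2
  simp only [hall, Finset.sum_const, Finset.card_univ, Fintype.card_fin, nsmul_eq_mul] at htr
  rcases mul_eq_zero.1 htr with h | h
  · exact absurd h (by exact_mod_cast n.succ_ne_zero)
  · exact h

/-- Every ad-nilpotent ideal of the upper triangular Borel subalgebra is spanned by matrix units. -/
theorem exists_eq_relIdeal {n : ℕ} {I : LieIdeal ℂ (upperBorel n)} (hI : IsAdNilpotentIdeal I) :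
    ∃ (S : Fin (n + 1) → Fin (n + 1) → Prop) (hS : UpClosed S), (∀ i j, S i j → i < j) ∧
      I = relIdeal S hS := by
  -- The relation collects the positions at which some element of `I` is nonzero.
  let S : Fin (n + 1) → Fin (n + 1) → Prop := fun i j => ∃ x ∈ I, entry x i j ≠ 0
  have hlt : ∀ i j, S i j → i < j := by
    rintro i j ⟨x, hx, h⟩
    by_contra! hij
    rcases hij.eq_or_lt with rfl | hij
    · exact h (entry_diag_eq_zero (hI x hx) _)
    · exact h (entry_of_lt x hij)
  have hunit : ∀ i j (h : S i j), unitUpper i j (hlt i j h) ∈ I := by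
    rintro i j h
    obtain ⟨x, hx, hxij⟩ := id h
    have h1 : ⁅diagUpper j, ⁅diagUpper i, x⁆⁆ ∈ I :=
      lie_mem_right ℂ _ I _ _ (lie_mem_right ℂ _ I _ _ hx)
    rw [lie_lie_diagUpper (hlt i j h)] at h1
    have h2 := I.smul_mem (-entry x i j)⁻¹ h1
    rwa [smul_smul, inv_mul_cancel₀ (neg_ne_zero.2 hxij), one_smul] at h2
  have hmem : ∀ i j (h : i < j), unitUpper i j h ∈ I → S i j := fun i j h hu => ⟨_, hu, by simp⟩
  have hS : UpClosed S := by
    intro a i j b hai hjb h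
    -- Bracketing with a unit on the left decreases the row, and on the right increases the column.
    have h1 : S a j := by
      rcases hai.eq_or_lt with rfl | hai
      · exact h
      · refine hmem a j (hai.trans (hlt i j h)) ?_
        rw [← lie_unitUpper hai (hlt i j h)]
        exact lie_mem_right ℂ _ I _ _ (hunit i j h)
    rcases hjb.eq_or_lt with rfl | hjb
    · exact h1
    · refine hmem a b ((hlt a j h1).trans hjb) ?_
      rw [← lie_unitUpper (hlt a j h1) hjb]
      exact lie_mem_left ℂ _ I _ _ (hunit a j h1)
  refine ⟨S, hS, hlt, le_antisymm (fun x hx i j hij => ?_) fun x hx => ?_⟩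
  · by_contra h
    exact hij ⟨x, hx, h⟩
  · rw [eq_sum_unitUpper x fun i => hx i i fun h => lt_irrefl _ (hlt i i h)]
    refine sum_mem fun p _ => ?_
    split_ifs with h
    · by_cases hp : S p.1 p.2
      · exact I.smul_mem _ (hunit _ _ hp)
      · rw [hx _ _ hp, zero_smul]
        exact I.zero_mem
    · exact I.zero_mem

/-! ### Reduction to counting and conclusion -/

open Classical in
/-- The dimensions of ad-nilpotent ideals are the sizes of the corresponding relations. -/
theorem mem_adNilpotentDims_upperBorel {n k : ℕ} {d : ℤ} :
    d ∈ adNilpotentDims (upperBorel n) k ↔ ∃ S : Fin (n + 1) → Fin (n + 1) → Prop,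
      UpClosed S ∧ (∀ i j, S i j → i < j) ∧ HasChain S k ∧ ¬ HasChain S (k + 1) ∧
      ((Finset.univ.filter fun p : Fin (n + 1) × Fin (n + 1) => S p.1 p.2).card : ℤ) = d := by
  constructor
  · rintro ⟨I, hI, hk, rfl⟩
    obtain ⟨S, hS, hlt, rfl⟩ := exists_eq_relIdeal hI
    rw [hasNilpotenceClass_relIdeal_iff hS hlt] at hk
    refine ⟨S, hS, hlt, hk.1, hk.2, ?_⟩
    rw [finrank_relIdeal hS hlt]
  · rintro ⟨S, hS, hlt, h1, h2, rfl⟩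
    refine ⟨relIdeal S hS, isAdNilpotentIdeal_relIdeal hS hlt,
      (hasNilpotenceClass_relIdeal_iff hS hlt).2 ⟨h1, h2⟩, ?_⟩
    rw [finrank_relIdeal hS hlt]

/-- Every Borel subalgebra of `sl(n+1, ℂ)` is conjugate to that of upper triangular matrices. -/
theorem IsBorel.exists_map_eq_upperBorel {n : ℕ} {b : LieSubalgebra ℂ (SL n)} (hb : IsBorel b) :
    ∃ e : SL n ≃ₗ⁅ℂ⁆ SL n, b.map (e : SL n →ₗ⁅ℂ⁆ SL n) = upperBorel n := by
  have := hb.prop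
  obtain ⟨e, he⟩ := exists_conj_mem_upperBorel b
  refine ⟨e, le_antisymm ?_ ?_⟩
  · rintro _ ⟨x, hx, rfl⟩
    exact he x hx
  · have hsol : LieAlgebra.IsSolvable ((upperBorel n).map (e.symm : SL n →ₗ⁅ℂ⁆ SL n)) := by
      have := isSolvable_upperBorel n
      exact (e.symm.ofSubalgebras (upperBorel n) _ rfl).symm.injective.lieAlgebra_isSolvable
    have hle : b ≤ (upperBorel n).map (e.symm : SL n →ₗ⁅ℂ⁆ SL n) := fun x hx =>
      ⟨e x, he x hx, e.symm_apply_apply x⟩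
    intro x hx
    exact ⟨e.symm x, hb.le_of_ge hsol hle ⟨x, hx, rfl⟩, e.apply_symm_apply x⟩

theorem theorem6p2 (n k : ℕ) (hkn : k ≤ n) (b : LieSubalgebra ℂ (SL n)) (hb : IsBorel b) :
    (1 ≤ k → IsLeast (adNilpotentDims b k)
      (((k + 1).choose 2 : ℤ) + ((k : ℤ) - 1) * ((n : ℤ) - k))) ∧
    IsGreatest (adNilpotentDims b k)
      (((n + 1).choose 2 : ℤ) - ((n : ℤ) + 1) * (((n + 1) / (k + 1) : ℕ) : ℤ)
        + ((k : ℤ) + 1) * ((((n + 1) / (k + 1) + 1).choose 2 : ℕ) : ℤ)) := by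
  obtain ⟨e, he⟩ := hb.exists_map_eq_upperBorel
  rw [adNilpotentDims_eq_of_equiv e he k]
  refine ⟨fun hk => ⟨?_, fun d hd => ?_⟩, ?_, fun d hd => ?_⟩
  · exact mem_adNilpotentDims_upperBorel.2 ⟨smallRel n k, smallRel_upClosed n k,
      fun _ _ h => h.1, hasChain_smallRel hkn, not_hasChain_smallRel n k, card_smallRel hk hkn⟩
  · obtain ⟨S, hS, hlt, h1, -, rfl⟩ := mem_adNilpotentDims_upperBorel.1 hd
    have h := card_ge_of_hasChain hS hlt h1
    zify [hk, hkn] at h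
    exact h
  · exact mem_adNilpotentDims_upperBorel.2 ⟨blockRel n k, blockRel_upClosed n k,
      fun _ _ => blockRel_lt, hasChain_blockRel hkn, not_hasChain_blockRel n k, card_blockRel n k⟩
  · obtain ⟨S, -, hlt, -, h2, rfl⟩ := mem_adNilpotentDims_upperBorel.1 hd
    exact card_le_of_not_hasChain hlt h2
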